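/- Let $g\colon\mathbb R^d\to\mathbb R$ be min-max affine, $g(x)=\min_{i\in I} g_i(x)$ with $g_i(x)=\max_{j\in J}(a_{ij}^\top x+b_{ij})$, where $I,J$ are finite nonempty index sets, $a_{ij}\in\mathbb R^d$ and $b_{ij}\in\mathbb R$. Let $X=\{x\in\mathbb R^d : c_k(x)\le 0,\ k\in K\}$, where $K$ is finite and every $c_k\colon\mathbb R^d\to\overline{\mathbb R}=\mathbb R\cup\{-\infty,\infty\}$ is proper, closed and convex. For $f\colon\mathbb R^d\to\overline{\mathbb R}$ write $\operatorname{dom} f=\{x: f(x)<\infty\}$, let $f^*(y)=\sup_{x\in\operatorname{dom} f}(y^\top x-f(x))$ be its conjugate, and, for $f$ proper, closed and convex, let its perspective be $\tilde f(x,t)=t f(x/t)$ for $t>0$, $\tilde f(x,0)=\sup_{y\in\operatorname{dom}(f^*)}y^\top x$, and $\tilde f(x,t)=\infty$ for $t<0$. Consider the following three values in $\overline{\mathbb R}$ (with $\inf\emptyset=\infty$, $\sup\emptyset=-\infty$): - $p'=\inf_{\mu\in\mathcal P(X)}\int_X g\,d\mu$, where $\mathcal P(X)$ is the set of Borel probability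 measures on $X$; - $\underline c=\inf\sum_{i\in I}\eta_i$ over $\eta_i,\lambda_i\in\mathbb R$ and $x_i\in\mathbb R^d$ subject to $\tilde c_k(x_i,\lambda_i)\le 0$ for all $i\in I$, $k\in K$; $\tilde g_i(x_i,\lambda_i)\le\eta_i$ for all $i\in I$; $\sum_{i\in I}\lambda_i=1$; and $\lambda\ge 0$; - $\overline c=\sup(-\alpha)$ over $\alpha,\beta_{ik}\in\mathbb R$ and $y_i,z_{ik}\in\mathbb R^d$ subject to $g_i^*(y_i)+\sum_{k\in K}\widetilde{c_k^*}(z_{ik},\beta_{ik})\le\alpha$ for all $i\in I$; $y_i+\sum_{k\in K}z_{ik}=0$ for all $i\in I$; and $\beta_{ik}\ge 0$ for all $i\in I$, $k\in K$. A problem $\inf\{f_0(w): f_r(w)\le 0,\ h_s(w)=0 \text{ for all } r,s\}$ with extended-real-valued functions $f_0,f_r,h_s$ on a finite-dimensional space admits a Slater point if it has a feasible $w$ that lies in the relative interior of the domain of each of $f_0$, all $f_r$ and all $h_s$, and satisfies $f_r(w)<0$ for every $r$ such that $f_r$ is not affine. Suppose that $X$ is bounded and that the problem $\overline c$ (written as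 the minimization of $\alpha$, with inequality constraints $g_i^*(y_i)+\sum_k\widetilde{c_k^*}(z_{ik},\beta_{ik})-\alpha\le 0$ and $-\beta_{ik}\le 0$ and the coordinates of $y_i+\sum_k z_{ik}=0$ as equality constraints) admits a Slater point. Then $\underline c=p'=\overline c$. Moreover, for every solution $(\eta^\star,\lambda^\star,x^\star)$ of $\underline c$, the discrete probability measure $\sum_{i\in I:\lambda_i^\star\neq 0}\lambda_i^\star\,\delta_{x_i^\star/\lambda_i^\star}$ solves $p'$, i.e. it belongs to $\mathcal P(X)$ and attains the infimum $p'$. -/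

import Mathlib

open MeasureTheory

noncomputable section

namespace MinMaxCert

/-! ### Extended-real-valued functions -/

section ExtendedReal

variable {E : Type*}

/-- Effective domain of an extended-real-valued function. -/
def dom (f : E → EReal) : Set E := {x | f x < ⊤}

/-- Proper: never `-∞` and not identically `+∞`. -/
def IsProper (f : E → EReal) : Prop := (∀ x, f x ≠ ⊥) ∧ ∃ x, f x ≠ ⊤

/-- Convexity of an extended-real-valued function: its epigraph (a subset of `E × ℝ`) is convex. -/
def IsConvex [AddCommGroup E] [Module ℝ E] (f : E → EReal) : Prop :=
  Convex ℝ {q : E × ℝ | f q.1 ≤ (q.2 : EReal)}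

/-- `f` is a real-valued affine function on the whole space. -/
def IsAffine [AddCommGroup E] [Module ℝ E] (f : E → EReal) : Prop :=
  ∃ A : E →ᵃ[ℝ] ℝ, ∀ x, f x = ((A x : ℝ) : EReal)

/-- The program `inf {f₀ w : f i w ≤ 0 for all i, h j w = 0 for all j}` admits a Slater point:
a feasible point in the relative interiors of the domains of all the functions involved, at which
every inequality constraint whose function is not affine holds strictly. -/
def AdmitsSlaterPoint [NormedAddCommGroup E] [NormedSpace ℝ E] {ι κ : Type*}
    (f₀ : E → EReal) (f : ι → E → EReal) (h : κ → E → EReal) : Prop :=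
  ∃ w : E, w ∈ intrinsicInterior ℝ (dom f₀) ∧
    (∀ i, w ∈ intrinsicInterior ℝ (dom (f i)) ∧ f i w ≤ 0 ∧ (¬ IsAffine (f i) → f i w < 0)) ∧
    (∀ j, w ∈ intrinsicInterior ℝ (dom (h j)) ∧ h j w = 0)

end ExtendedReal

/-! ### Conjugates and perspectives on `ℝᵈ` -/

/-- `ℝᵈ` with the Euclidean inner product. -/
abbrev Vec (d : ℕ) : Type := EuclideanSpace ℝ (Fin d)

section Conjugate

variable {d : ℕ}

/-- The conjugate `f^*(y) = sup_{x ∈ dom f} (yᵀ x - f x)`. -/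
def conj (f : Vec d → EReal) (y : Vec d) : EReal :=
  ⨆ x ∈ dom f, (((inner ℝ y x : ℝ) : EReal) - f x)

/-- The perspective of `f`: `t f(x/t)` for `t > 0` and `sup_{y ∈ dom f^*} yᵀ x` for `t = 0`.
It is a function on `ℝᵈ × [0, ∞)`; as usual it is extended by `+∞` to `t < 0`. -/
def persp (f : Vec d → EReal) (x : Vec d) (t : ℝ) : EReal :=
  if 0 < t then (t : EReal) * f (t⁻¹ • x)
  else if t = 0 then ⨆ y ∈ dom (conj f), ((inner ℝ y x : ℝ) : EReal)
  else ⊤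

end Conjugate

/-! ### Min-max affine functions and the support set -/

section MinMax

variable {d : ℕ} {I J K : Type*} [Fintype I] [Fintype J] [Fintype K] [Nonempty I] [Nonempty J]

/-- `x ↦ max_j (a_jᵀ x + b_j)`. -/
def maxAffine (a : J → Vec d) (b : J → ℝ) (x : Vec d) : ℝ :=
  Finset.univ.sup' Finset.univ_nonempty fun j => inner ℝ (a j) x + b j

/-- `g(x) = min_i max_j (a_ijᵀ x + b_ij)`. -/
def minMaxAffine (a : I → J → Vec d) (b : I → J → ℝ) (x : Vec d) : ℝ :=
  Finset.univ.inf' Finset.univ_nonempty fun i => maxAffine (a i) (b i) x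

/-- The component `g_i` as an extended-real-valued function. -/
def comp (a : I → J → Vec d) (b : I → J → ℝ) (i : I) (x : Vec d) : EReal :=
  ((maxAffine (a i) (b i) x : ℝ) : EReal)

/-- `X = {x : c_k(x) ≤ 0 for all k}`. -/
def supportSet (c : K → Vec d → EReal) : Set (Vec d) := {x | ∀ k, c k x ≤ 0}

/-! ### The lifted problem `p'` -/

/-- Borel probability measures on `X`, seen as Borel probability measures on `ℝᵈ` that give
no mass to the complement of `X`. -/
def probOn (X : Set (Vec d)) : Set (Measure (Vec d)) :=
  {μ | IsProbabilityMeasure μ ∧ μ Xᶜ = 0}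

/-- The value `p' = inf_{μ ∈ 𝒫(X)} ∫ g dμ`, an extended real number (`+∞` if `X` is empty). -/
def liftedValue (g : Vec d → ℝ) (X : Set (Vec d)) : EReal :=
  ⨅ μ ∈ probOn X, ((∫ x, g x ∂μ : ℝ) : EReal)

/-- `μ` solves the lifted problem. -/
def SolvesLifted (g : Vec d → ℝ) (X : Set (Vec d)) (μ : Measure (Vec d)) : Prop :=
  μ ∈ probOn X ∧ ((∫ x, g x ∂μ : ℝ) : EReal) = liftedValue g X

theorem continuous_minMaxAffine (a : I → J → Vec d) (b : I → J → ℝ) :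
    Continuous (minMaxAffine a b) := by
  unfold minMaxAffine maxAffine
  refine Continuous.finset_inf'_apply _ fun i _ => ?_
  refine Continuous.finset_sup'_apply _ fun j _ => ?_
  fun_prop

/-- On a bounded set every expectation in the lifted problem is that of an integrable function,
so the integrals above carry no default value. -/
theorem integrable_minMaxAffine (a : I → J → Vec d) (b : I → J → ℝ) {X : Set (Vec d)}
    (hX : Bornology.IsBounded X) {μ : Measure (Vec d)} (hμ : μ ∈ probOn X) :
    Integrable (minMaxAffine a b) μ := by
  obtain ⟨h1, h2⟩ := hμ
  have hc := continuous_minMaxAffine a b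
  obtain ⟨C, hC⟩ := hX.isCompact_closure.exists_bound_of_continuousOn hc.continuousOn
  refine Integrable.of_bound hc.aestronglyMeasurable C ?_
  have h3 : ∀ᵐ x ∂μ, x ∈ X := by
    rw [ae_iff]
    exact h2
  filter_upwards [h3] with x hx
  exact hC x (subset_closure hx)

/-! ### The finite convex program -/

/-- Feasibility of `(η, lam, x)` for the finite convex (minimization) program:
`persp c_k (x_i, λ_i) ≤ 0`, `persp g_i (x_i, λ_i) ≤ η_i`, `∑ λ_i = 1`, `λ ≥ 0`. -/
structure PrimalFeasible (a : I → J → Vec d) (b : I → J → ℝ) (c : K → Vec d → EReal)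
    (η lam : I → ℝ) (x : I → Vec d) : Prop where
  constr : ∀ i k, persp (c k) (x i) (lam i) ≤ 0
  epi : ∀ i, persp (comp a b i) (x i) (lam i) ≤ ((η i : ℝ) : EReal)
  sum_eq_one : ∑ i, lam i = 1
  nonneg : ∀ i, 0 ≤ lam i

/-- The value of the finite convex program. -/
def primalValue (a : I → J → Vec d) (b : I → J → ℝ) (c : K → Vec d → EReal) : EReal :=
  ⨅ (η : I → ℝ) (lam : I → ℝ) (x : I → Vec d) (_ : PrimalFeasible a b c η lam x),
    ((∑ i, η i : ℝ) : EReal)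

/-- `(η, lam, x)` is an optimal solution of the finite convex program. -/
def SolvesPrimal (a : I → J → Vec d) (b : I → J → ℝ) (c : K → Vec d → EReal)
    (η lam : I → ℝ) (x : I → Vec d) : Prop :=
  PrimalFeasible a b c η lam x ∧ ((∑ i, η i : ℝ) : EReal) = primalValue a b c

/-- The discrete measure `∑_{i : λ_i ≠ 0} λ_i δ_{x_i / λ_i}`. -/
def discreteMeasure (lam : I → ℝ) (x : I → Vec d) : Measure (Vec d) :=
  ∑ i with lam i ≠ 0, ENNReal.ofReal (lam i) • Measure.dirac ((lam i)⁻¹ • x i)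

/-! ### The dual program -/

/-- The space of variables `(α, β, y, z)` of the dual program. -/
abbrev DualVar (d : ℕ) (I K : Type*) : Type _ :=
  ℝ × (I → K → ℝ) × (I → Vec d) × (I → K → Vec d)

/-- The function `g_i^*(y_i) + ∑_k persp (c_k^*) (z_ik, β_ik) - α`. -/
def dualConstr (a : I → J → Vec d) (b : I → J → ℝ) (c : K → Vec d → EReal) (i : I) :
    DualVar d I K → EReal :=
  fun (α, β, y, z) =>
    conj (comp a b i) (y i) + ∑ k, persp (conj (c k)) (z i k) (β i k) - ((α : ℝ) : EReal)

/-- Feasibility of `(α, β, y, z)` for the dual program. -/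
structure DualFeasible (a : I → J → Vec d) (b : I → J → ℝ) (c : K → Vec d → EReal)
    (α : ℝ) (β : I → K → ℝ) (y : I → Vec d) (z : I → K → Vec d) : Prop where
  constr : ∀ i, conj (comp a b i) (y i) + ∑ k, persp (conj (c k)) (z i k) (β i k)
    ≤ ((α : ℝ) : EReal)
  balance : ∀ i, y i + ∑ k, z i k = 0
  nonneg : ∀ i k, 0 ≤ β i k

/-- The value of the dual program: maximize `-α` over all feasible `(α, β, y, z)`. -/
def dualValue (a : I → J → Vec d) (b : I → J → ℝ) (c : K → Vec d → EReal) : EReal :=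
  ⨆ (α : ℝ) (β : I → K → ℝ) (y : I → Vec d) (z : I → K → Vec d)
    (_ : DualFeasible a b c α β y z), ((-α : ℝ) : EReal)

/-- The dual program admits a Slater point. It is written as the minimization of `α` subject to
the inequality constraints `dualConstr i ≤ 0` and `-β_ik ≤ 0` and the scalar equality constraints
`(y_i + ∑_k z_ik)_l = 0`. -/
def DualSlater (a : I → J → Vec d) (b : I → J → ℝ) (c : K → Vec d → EReal) : Prop :=
  AdmitsSlaterPoint (E := DualVar d I K) (ι := I ⊕ (I × K)) (κ := I × Fin d)
    (fun (α, _, _, _) => ((α : ℝ) : EReal))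
    (Sum.elim (dualConstr a b c) fun (i, k) (_, β, _, _) => ((-(β i k) : ℝ) : EReal))
    (fun (i, l) (_, _, y, z) => (((y i + ∑ k, z i k) l : ℝ) : EReal))

end MinMax

end MinMaxCert

end

/-!
Write `g_i` for the convex pieces of the min-max affine function `g = min_i g_i` and `X` for the
support set. All three values equal the infimum of `g` over `X`.

The lifted problem has this value because a function is at most its mean at some point of the
support (`le_liftedValue`), while Dirac measures show that the mean cannot do better
(`liftedValue_le_of_mem`).

For the finite convex program, a point `x` of `X` at which `g x = g_i x` gives the feasible choice
of putting all the weight on `i`. Conversely, a feasible choice gives the discrete measure, which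
lives on `X` and whose mean of `g` is at most `∑ η_i`. The one delicate case is `λ_i = 0`: then
`x_i` is a direction of recession of every `c_k`, hence of the bounded set `X`, so that `x_i = 0`
and `η_i ≥ 0` (`PrimalFeasible.eq_zero`, `PrimalFeasible.nonneg_of_eq_zero`).

The dual program splits over `i` into the duals of the problems `inf_X g_i`. Weak duality is the
Fenchel–Young inequality (`DualFeasible.neg_le`). Strong duality is `exists_dual_certificate`: let
`S` be the set of all `((u, ε), r)` such that some `x` satisfies `g_i x ≤ r` and
`c_k (x + u_k) ≤ ε_k` for all `k`. It is convex, and when no point of `X` has `g_i x ≤ t` a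
functional separating `((0, 0), t)` from `S` is a dual point of value at least `t`. The separation
needs `((0, 0), t)` to lie off the closure of `S` (`exists_le_of_mem_closure`), which is where the
Slater point enters. It says that a half-space through the origin containing the domains of all
the conjugates contains them in its boundary (`DualSlater.exists_point`), so that a common
direction of recession is one along which all the functions are constant; projecting these
directions away keeps the points `x` bounded in the limit. The argument covers an empty `X`,
for which it shows that the dual program is unbounded.

The separations are between a point and a convex set with a known non-vertical lower bound
(`exists_nonvertical_separating`), which also yields the Fenchel–Moreau theorem `conj_conj`.
-/

noncomputable section

namespace MinMaxCert

/-! ### Affine minorants from separation -/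

section Separation

variable {E : Type*} [NormedAddCommGroup E] [NormedSpace ℝ E]

/-- A point off the closure of a convex, upward closed set is strictly separated from it by a
hyperplane whose vertical coefficient `-ρ` is nonpositive; the hyperplane may be vertical. -/
theorem exists_separating {C : Set (E × ℝ)} (hC : Convex ℝ C) (hne : C.Nonempty)
    (hup : ∀ e r r', (e, r) ∈ C → r ≤ r' → (e, r') ∈ C) {p : E} {t : ℝ}
    (hp : (p, t) ∉ closure C) :
    ∃ (l : E →L[ℝ] ℝ) (ρ δ : ℝ), 0 ≤ ρ ∧ 0 < δ ∧
      ∀ e r, (e, r) ∈ C → l e - ρ * r ≤ l p - ρ * t - δ := by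
  obtain ⟨f, u, hf, hu⟩ := geometric_hahn_banach_closed_point hC.closure isClosed_closure hp
  have hsplit : ∀ e r, f (e, r) = f (e, 0) + r * f (0, 1) := by
    intro e r
    have : ((e, r) : E × ℝ) = (e, 0) + r • (0, 1) := by simp
    rw [this, map_add, map_smul, smul_eq_mul]
  have hρ : f (0, 1) ≤ 0 := by
    by_contra! h
    obtain ⟨⟨e, r⟩, he⟩ := hne
    obtain ⟨n, hn⟩ := exists_nat_gt ((u - f (e, r)) / f (0, 1))
    rw [div_lt_iff₀ h] at hn
    have h1 := hf _ (subset_closure (hup e r (r + n) he (by simp)))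
    rw [hsplit] at h1 hn
    linarith
  refine ⟨f.comp (ContinuousLinearMap.inl ℝ E ℝ), -f (0, 1), f (p, t) - u, by linarith,
    by linarith, fun e r he => ?_⟩
  have h1 := hf _ (subset_closure he)
  rw [hsplit] at h1
  have h2 := hsplit p t
  simp only [ContinuousLinearMap.comp_apply, ContinuousLinearMap.inl_apply]
  linarith

/-- If a convex, upward closed set lies above some non-vertical hyperplane, then every point off
its closure is separated from it by a non-vertical hyperplane: add a large multiple of a
separating functional to the given non-vertical one. -/
theorem exists_nonvertical_separating {C : Set (E × ℝ)} (hC : Convex ℝ C) (hne : C.Nonempty)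
    (hup : ∀ e r r', (e, r) ∈ C → r ≤ r' → (e, r') ∈ C) {p : E} {t : ℝ}
    (hp : (p, t) ∉ closure C)
    (hbase : ∃ (l : E →L[ℝ] ℝ) (M : ℝ), ∀ e r, (e, r) ∈ C → l e - r ≤ M) :
    ∃ l : E →L[ℝ] ℝ, ∀ e r, (e, r) ∈ C → l e - r ≤ l p - t := by
  obtain ⟨l₁, ρ, δ, hρ, hδ, h₁⟩ := exists_separating hC hne hup hp
  obtain ⟨l₀, M, h₀⟩ := hbase
  obtain ⟨n, hn⟩ := exists_nat_gt ((M - l₀ p + t) / δ)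
  rw [div_lt_iff₀ hδ] at hn
  have hpos : (0 : ℝ) < 1 + n * ρ := by positivity
  refine ⟨(1 + n * ρ)⁻¹ • (l₀ + (n : ℝ) • l₁), fun e r he => ?_⟩
  have ha := h₀ e r he
  have hb := mul_le_mul_of_nonneg_left (h₁ e r he) (Nat.cast_nonneg (α := ℝ) n)
  have hc : l₀ e + n * l₁ e - (1 + n * ρ) * r ≤ l₀ p + n * l₁ p - (1 + n * ρ) * t := by
    nlinarith
  have hd := mul_le_mul_of_nonneg_left hc (inv_nonneg.2 hpos.le)
  simp only [mul_sub, inv_mul_cancel_left₀ hpos.ne'] at hd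
  simpa [mul_add] using hd

end Separation

/-! ### Conjugates and biconjugates -/

section Conjugates

variable {d : ℕ} {f : Vec d → EReal}

theorem exists_real_of_mem_dom {x : Vec d} (hf : ∀ x, f x ≠ ⊥) (hx : x ∈ dom f) :
    ∃ s : ℝ, f x = s :=
  ⟨(f x).toReal, (EReal.coe_toReal (ne_of_lt hx) (hf x)).symm⟩

theorem mem_dom_of_le {x : Vec d} {s : ℝ} (h : f x ≤ s) : x ∈ dom f :=
  lt_of_le_of_lt h (EReal.coe_lt_top s)

/-- The Fenchel–Young inequality. -/
theorem inner_le_add_of_conj_le {x y : Vec d} {s r : ℝ} (hx : f x ≤ s) (hy : conj f y ≤ r) :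
    inner ℝ y x ≤ r + s := by
  have h1 : ((inner ℝ y x : ℝ) : EReal) - s ≤ r :=
    (EReal.sub_le_sub le_rfl hx).trans
      ((le_iSup₂ (f := fun x (_ : x ∈ dom f) => ((inner ℝ y x : ℝ) : EReal) - f x) x
        (mem_dom_of_le hx)).trans hy)
  rw [← EReal.coe_sub, EReal.coe_le_coe_iff] at h1
  linarith

theorem conj_le_of_forall (hf : ∀ x, f x ≠ ⊥) {y : Vec d} {r : ℝ}
    (h : ∀ x (s : ℝ), f x ≤ s → inner ℝ y x - s ≤ r) : conj f y ≤ r := by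
  refine iSup₂_le fun x hx => ?_
  obtain ⟨s, hs⟩ := exists_real_of_mem_dom hf hx
  rw [hs, ← EReal.coe_sub, EReal.coe_le_coe_iff]
  exact h x s hs.le

theorem conj_ne_bot (hf : IsProper f) (y : Vec d) : conj f y ≠ ⊥ := by
  obtain ⟨x, hx⟩ := hf.2
  have hxd : x ∈ dom f := lt_top_iff_ne_top.2 hx
  obtain ⟨s, hs⟩ := exists_real_of_mem_dom hf.1 hxd
  intro h
  have h1 := inner_le_add_of_conj_le (f := f) (x := x) (y := y) (s := s)
    (r := inner ℝ y x - s - 1) hs.le (by rw [h]; exact bot_le)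
  linarith

theorem conj_conj_le (f : Vec d → EReal) (x : Vec d) : conj (conj f) x ≤ f x := by
  refine EReal.le_of_forall_lt_iff_le.1 fun s hs => ?_
  refine iSup₂_le fun y hy => ?_
  by_cases hb : conj f y = ⊥
  · have := inner_le_add_of_conj_le (y := y) (r := inner ℝ y x - s - 1) hs.le (by rw [hb]; exact bot_le)
    linarith
  · have hr : conj f y = ((conj f y).toReal : ℝ) := (EReal.coe_toReal (ne_of_lt hy) hb).symm
    have := inner_le_add_of_conj_le hs.le hr.le
    rw [hr, ← EReal.coe_sub, EReal.coe_le_coe_iff, real_inner_comm]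
    linarith

theorem isClosed_epigraph (hcl : LowerSemicontinuous f) :
    IsClosed {q : Vec d × ℝ | f q.1 ≤ (q.2 : EReal)} :=
  hcl.isClosed_epigraph.preimage
    (f := fun q : Vec d × ℝ => ((q.1, (q.2 : EReal)) : Vec d × EReal))
    (continuous_fst.prodMk (continuous_coe_real_ereal.comp continuous_snd))

/-- Every continuous linear functional on `ℝᵈ` is an inner product. -/
theorem exists_inner_eq (l : Vec d →L[ℝ] ℝ) : ∃ y : Vec d, ∀ x, l x = inner ℝ y x :=
  ⟨(InnerProductSpace.toDual ℝ (Vec d)).symm l, fun x => by simp⟩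

/-- A real number below `f x₀` is reached at `x₀` by an affine minorant of `f`. -/
theorem exists_affine_minorant (hf : IsProper f) (hcl : LowerSemicontinuous f)
    (hcv : IsConvex f) {x₀ : Vec d} {t : ℝ} (ht : (t : EReal) < f x₀) :
    ∃ y : Vec d, ∀ x (s : ℝ), f x ≤ s → inner ℝ y x - s ≤ inner ℝ y x₀ - t := by
  have hc := isClosed_epigraph hcl
  have hup : ∀ (e : Vec d) (r r' : ℝ), (e, r) ∈ {q : Vec d × ℝ | f q.1 ≤ (q.2 : EReal)} → r ≤ r' →
      (e, r') ∈ {q : Vec d × ℝ | f q.1 ≤ (q.2 : EReal)} :=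
    fun e r r' h h' => le_trans (α := EReal) h (EReal.coe_le_coe_iff.2 h')
  obtain ⟨x₁, hx₁⟩ := hf.2
  obtain ⟨s₁, hs₁⟩ := exists_real_of_mem_dom hf.1 (lt_top_iff_ne_top.2 hx₁ : x₁ ∈ dom f)
  have hne : {q : Vec d × ℝ | f q.1 ≤ (q.2 : EReal)}.Nonempty := ⟨(x₁, s₁), hs₁.le⟩
  have hbase : ∃ (l : Vec d →L[ℝ] ℝ) (M : ℝ),
      ∀ e r, (e, r) ∈ {q : Vec d × ℝ | f q.1 ≤ (q.2 : EReal)} → l e - r ≤ M := by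
    -- a hyperplane strictly below the point `(x₁, f x₁)` of the epigraph cannot be vertical
    obtain ⟨l, ρ, δ, hρ, hδ, h⟩ := exists_separating hcv hne hup
      (p := x₁) (t := s₁ - 1) (by
        rw [hc.closure_eq]
        intro h
        have h : f x₁ ≤ ((s₁ - 1 : ℝ) : EReal) := h
        rw [hs₁, EReal.coe_le_coe_iff] at h
        linarith)
    have hρ' : 0 < ρ := by
      have := h x₁ s₁ hs₁.le
      nlinarith
    refine ⟨ρ⁻¹ • l, ρ⁻¹ * (l x₁ - ρ * (s₁ - 1) - δ), fun e r he => ?_⟩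
    have h1 := mul_le_mul_of_nonneg_left (h e r he) (inv_nonneg.2 hρ)
    rw [mul_sub, inv_mul_cancel_left₀ hρ'.ne'] at h1
    simpa using h1
  obtain ⟨l, hl⟩ := exists_nonvertical_separating hcv hne hup (p := x₀) (t := t)
    (by rw [hc.closure_eq]; exact not_le.2 ht) hbase
  obtain ⟨y, hy⟩ := exists_inner_eq l
  refine ⟨y, fun x s hs => ?_⟩
  have := hl x s hs
  rwa [hy, hy] at this

/-- The Fenchel–Moreau theorem. -/
theorem conj_conj (hf : IsProper f) (hcl : LowerSemicontinuous f) (hcv : IsConvex f) :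
    conj (conj f) = f := by
  funext x
  refine le_antisymm (conj_conj_le f x) ?_
  refine EReal.ge_of_forall_gt_iff_ge.1 fun t ht => ?_
  obtain ⟨y, hy⟩ := exists_affine_minorant hf hcl hcv ht
  have h1 : conj f y ≤ ((inner ℝ y x - t : ℝ) : EReal) := conj_le_of_forall hf.1 hy
  refine le_trans ?_ (le_iSup₂ (f := fun y (_ : y ∈ dom (conj f)) =>
    ((inner ℝ x y : ℝ) : EReal) - conj f y) y (mem_dom_of_le h1))
  refine le_trans ?_ (EReal.sub_le_sub le_rfl h1)
  rw [← EReal.coe_sub, EReal.coe_le_coe_iff, real_inner_comm]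
  linarith

theorem dom_conj_nonempty (hf : IsProper f) (hcl : LowerSemicontinuous f) (hcv : IsConvex f) :
    (dom (conj f)).Nonempty := by
  obtain ⟨x, hx⟩ := hf.2
  obtain ⟨s, hs⟩ := exists_real_of_mem_dom hf.1 (lt_top_iff_ne_top.2 hx : x ∈ dom f)
  obtain ⟨y, hy⟩ := exists_affine_minorant hf hcl hcv (x₀ := x) (t := s - 1)
    (by rw [hs, EReal.coe_lt_coe_iff]; linarith)
  exact ⟨y, mem_dom_of_le (conj_le_of_forall hf.1 hy)⟩

/-- `f` depends on `x` only through the pairings of `x` with the domain of the conjugate. -/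
theorem eq_of_inner_eq (hf : IsProper f) (hcl : LowerSemicontinuous f) (hcv : IsConvex f)
    {x x' : Vec d} (h : ∀ y ∈ dom (conj f), inner ℝ y x = inner ℝ y x') : f x = f x' := by
  rw [← conj_conj hf hcl hcv]
  unfold conj
  refine iSup_congr fun y => iSup_congr fun hy => ?_
  rw [real_inner_comm, h y hy, real_inner_comm]

/-- If `y ᵀ h ≤ 0` on the domain of `f^*`, then `h` is a direction of recession of `f`. -/
theorem add_smul_le (hf : IsProper f) (hcl : LowerSemicontinuous f) (hcv : IsConvex f)
    {x h : Vec d} (hh : ∀ y ∈ dom (conj f), inner ℝ y h ≤ 0) {s : ℝ} (hs : 0 ≤ s) :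
    f (x + s • h) ≤ f x := by
  rw [← conj_conj hf hcl hcv]
  unfold conj
  refine iSup₂_mono fun y hy => EReal.sub_le_sub ?_ le_rfl
  rw [EReal.coe_le_coe_iff, inner_add_left, inner_smul_left, real_inner_comm y h]
  have := mul_nonneg_of_nonpos_of_nonpos (hh y hy) (neg_nonpos.2 hs)
  simp
  nlinarith

end Conjugates

/-! ### Perspectives of conjugates -/

section Perspectives

variable {d : ℕ} {f : Vec d → EReal}

theorem persp_of_pos (f : Vec d → EReal) (x : Vec d) {t : ℝ} (ht : 0 < t) :
    persp f x t = (t : EReal) * f (t⁻¹ • x) := if_pos ht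

theorem persp_zero (f : Vec d → EReal) (x : Vec d) :
    persp f x 0 = ⨆ y ∈ dom (conj f), ((inner ℝ y x : ℝ) : EReal) := by
  simp [persp]

theorem persp_of_neg (f : Vec d → EReal) (x : Vec d) {t : ℝ} (ht : t < 0) :
    persp f x t = ⊤ := by
  simp [persp, ht.not_gt, ht.ne]

theorem coe_mul_le_coe_iff {t r : ℝ} (ht : 0 < t) (u : EReal) :
    (t : EReal) * u ≤ r ↔ u ≤ ((t⁻¹ * r : ℝ) : EReal) := by
  induction u with
  | bot => simp [EReal.coe_mul_bot_of_pos ht]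
  | top => rw [EReal.coe_mul_top_of_pos ht]; simp [-EReal.coe_mul]
  | coe u =>
    rw [← EReal.coe_mul, EReal.coe_le_coe_iff, EReal.coe_le_coe_iff, le_inv_mul_iff₀ ht]

/-- The Fenchel–Young inequality for the perspective of a conjugate. -/
theorem inner_le_of_persp_conj_le {z x : Vec d} {β s r : ℝ} (hβ : 0 ≤ β) (hx : f x ≤ s)
    (hz : persp (conj f) z β ≤ r) : inner ℝ z x ≤ β * s + r := by
  rcases hβ.eq_or_lt with rfl | hβ
  · rw [persp_zero] at hz
    have h := (iSup₂_le_iff.1 hz) x (mem_dom_of_le ((conj_conj_le f x).trans hx))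
    rw [EReal.coe_le_coe_iff, real_inner_comm] at h
    linarith
  · rw [persp_of_pos _ _ hβ, coe_mul_le_coe_iff hβ] at hz
    have h := mul_le_mul_of_nonneg_left (inner_le_add_of_conj_le hx hz) hβ.le
    rw [inner_smul_left, mul_add] at h
    simp only [conj_trivial, mul_inv_cancel_left₀ hβ.ne'] at h
    linarith

theorem persp_conj_le_of_forall (hf : IsProper f) (hcl : LowerSemicontinuous f)
    (hcv : IsConvex f) {z : Vec d} {β r : ℝ} (hβ : 0 ≤ β)
    (h : ∀ x (s : ℝ), f x ≤ s → inner ℝ z x - β * s ≤ r) : persp (conj f) z β ≤ r := by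
  rcases hβ.eq_or_lt with rfl | hβ
  · rw [persp_zero, conj_conj hf hcl hcv]
    refine iSup₂_le fun x hx => ?_
    obtain ⟨s, hs⟩ := exists_real_of_mem_dom hf.1 hx
    have := h x s hs.le
    rw [EReal.coe_le_coe_iff, real_inner_comm]
    linarith
  · rw [persp_of_pos _ _ hβ, coe_mul_le_coe_iff hβ]
    refine conj_le_of_forall hf.1 fun x s hs => ?_
    have h1 := mul_le_mul_of_nonneg_left (h x s hs) (inv_nonneg.2 hβ.le)
    rw [inner_smul_left]
    rw [mul_sub, inv_mul_cancel_left₀ hβ.ne'] at h1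
    simpa using h1

theorem persp_conj_ne_bot (hf : IsProper f) (z : Vec d) (β : ℝ) : persp (conj f) z β ≠ ⊥ := by
  rcases lt_or_ge β 0 with hβ | hβ
  · simp [persp_of_neg _ _ hβ]
  obtain ⟨x, hx⟩ := hf.2
  obtain ⟨s, hs⟩ := exists_real_of_mem_dom hf.1 (lt_top_iff_ne_top.2 hx : x ∈ dom f)
  intro h
  have h1 := inner_le_of_persp_conj_le (r := inner ℝ z x - β * s - 1) hβ hs.le
    (by rw [h]; exact bot_le)
  linarith

theorem nonneg_of_persp_ne_top {z : Vec d} {β : ℝ} (h : persp f z β ≠ ⊤) : 0 ≤ β := by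
  by_contra! hβ
  exact h (persp_of_neg _ _ hβ)

/-- A half-space `{y | yᵀ h ≤ 0}` that contains the domain of `f^*` contains every `z` at which
the perspective of `f^*` is finite. -/
theorem inner_nonpos_of_persp_conj_ne_top (hf : IsProper f) {h z : Vec d} {β : ℝ}
    (hne : (dom (conj f)).Nonempty)
    (hh : ∀ y ∈ dom (conj f), inner ℝ y h ≤ 0) (hz : persp (conj f) z β ≠ ⊤) :
    inner ℝ z h ≤ 0 := by
  have hr := (EReal.coe_toReal hz (persp_conj_ne_bot hf z β)).symm
  set r := (persp (conj f) z β).toReal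
  have hβ := nonneg_of_persp_ne_top hz
  obtain ⟨y, hy⟩ := hne
  have hc := (EReal.coe_toReal (ne_of_lt hy) (conj_ne_bot hf y)).symm
  set c := (conj f y).toReal
  -- `y + n z` stays in a multiple of the domain, whatever the size of `n`
  have key : ∀ n : ℕ, inner ℝ (y + (n : ℝ) • z) h ≤ 0 := by
    intro n
    have hpos : 0 < 1 + n * β := by positivity
    have hmem : (1 + n * β)⁻¹ • (y + (n : ℝ) • z) ∈ dom (conj f) := by
      refine mem_dom_of_le (s := (1 + n * β)⁻¹ * (c + n * r)) (conj_le_of_forall hf.1 ?_)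
      intro x s hs
      have h1 := inner_le_add_of_conj_le hs hc.le
      have h2 := mul_le_mul_of_nonneg_left (inner_le_of_persp_conj_le hβ hs hr.le)
        (Nat.cast_nonneg (α := ℝ) n)
      rw [inner_smul_left, inner_add_left, inner_smul_left]
      simp only [conj_trivial]
      rw [sub_le_iff_le_add, inv_mul_le_iff₀ hpos, mul_add, mul_inv_cancel_left₀ hpos.ne']
      nlinarith
    have := hh _ hmem
    rw [inner_smul_left] at this
    simp only [conj_trivial] at this
    exact nonpos_of_mul_nonpos_right this (inv_pos.2 hpos)
  by_contra! hpos
  obtain ⟨n, hn⟩ := exists_nat_gt (-inner ℝ y h / inner ℝ z h)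
  rw [div_lt_iff₀ hpos] at hn
  have := key n
  rw [inner_add_left, inner_smul_left] at this
  simp only [conj_trivial] at this
  linarith

end Perspectives

/-! ### Strong duality for a single convex program -/

section StrongDuality

variable {d : ℕ} {K : Type*}

/-- The pairs of a perturbation `(u_k, ε_k)_k` and a level `r` that some `x` with
`c_k (x + u_k) ≤ ε_k` for all `k` reaches, `f₀ x ≤ r`. Shifting the argument of each `c_k` separately
makes the dual multipliers split into the conjugates of `f₀` and of the single `c_k`. -/
def perturbationEpigraph (f₀ : Vec d → EReal) (c : K → Vec d → EReal) :
    Set ((K → Vec d × ℝ) × ℝ) :=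
  {q | ∃ x, f₀ x ≤ (q.2 : EReal) ∧ ∀ k, c k (x + (q.1 k).1) ≤ ((q.1 k).2 : EReal)}

/-- Every half-space through the origin that contains the domains of `f₀^*` and of all `c_k^*`
contains them in its boundary. In terms of `f₀` and `c_k`: their common directions of recession are
directions along which all of them are constant. -/
def NoOneSidedRecession (f₀ : Vec d → EReal) (c : K → Vec d → EReal) : Prop :=
  ∀ h : Vec d, (∀ y ∈ dom (conj f₀), inner ℝ y h ≤ 0) →
    (∀ k, ∀ y ∈ dom (conj (c k)), inner ℝ y h ≤ 0) →
    (∀ y ∈ dom (conj f₀), inner ℝ y h = 0) ∧ ∀ k, ∀ y ∈ dom (conj (c k)), inner ℝ y h = 0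

theorem convex_perturbationEpigraph {f₀ : Vec d → EReal} {c : K → Vec d → EReal}
    (h₀ : IsConvex f₀) (hc : ∀ k, IsConvex (c k)) : Convex ℝ (perturbationEpigraph f₀ c) := by
  rintro ⟨q, r⟩ ⟨x, hx, hq⟩ ⟨q', r'⟩ ⟨x', hx', hq'⟩ s t hs ht hst
  refine ⟨s • x + t • x', h₀ (x := (x, r)) hx (y := (x', r')) hx' hs ht hst, fun k => ?_⟩
  have := hc k (x := (x + (q k).1, (q k).2)) (hq k) (y := (x' + (q' k).1, (q' k).2)) (hq' k)
    hs ht hst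
  have e : s • x + t • x' + (s • (q k).1 + t • (q' k).1) =
      s • (x + (q k).1) + t • (x' + (q' k).1) := by
    simp only [smul_add]
    abel
  exact (congrArg (c k) e).le.trans this

variable [Fintype K]

/-- A limit of rescaled points of growing norm in the sublevel sets of translates of `f` is a
direction of recession: the domain of `f^*` lies on one side of it. -/
theorem inner_nonpos_of_tendsto {f : Vec d → EReal} (hf : IsProper f) {x u : ℕ → Vec d}
    {ε : ℕ → ℝ} {u₀ h y : Vec d} {ε₀ : ℝ}
    (hu : Filter.Tendsto u Filter.atTop (nhds u₀)) (hε : Filter.Tendsto ε Filter.atTop (nhds ε₀))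
    (hx : Filter.Tendsto (fun n => ‖x n‖) Filter.atTop Filter.atTop)
    (hh : Filter.Tendsto (fun n => ‖x n‖⁻¹ • x n) Filter.atTop (nhds h))
    (hle : ∀ n, f (x n + u n) ≤ ε n) (hy : y ∈ dom (conj f)) : inner ℝ y h ≤ 0 := by
  have hc := (EReal.coe_toReal (ne_of_lt hy) (conj_ne_bot hf y)).symm
  set r := (conj f y).toReal
  have h1 : ∀ n, inner ℝ y (‖x n‖⁻¹ • x n) ≤ ‖x n‖⁻¹ * (r + ε n - inner ℝ y (u n)) := by
    intro n
    have := inner_le_add_of_conj_le (hle n) hc.le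
    rw [inner_add_right] at this
    rw [inner_smul_right]
    exact mul_le_mul_of_nonneg_left (by linarith) (by positivity)
  have h2 : Filter.Tendsto (fun n => ‖x n‖⁻¹ * (r + ε n - inner ℝ y (u n))) Filter.atTop
      (nhds (0 * (r + ε₀ - inner ℝ y u₀))) :=
    hx.inv_tendsto_atTop.mul ((hε.const_add r).sub (tendsto_const_nhds.inner hu))
  rw [zero_mul] at h2
  exact le_of_tendsto_of_tendsto' (tendsto_const_nhds.inner hh) h2 h1

theorem le_of_tendsto_epigraph {f : Vec d → EReal} (hcl : LowerSemicontinuous f)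
    {x : ℕ → Vec d} {ε : ℕ → ℝ} {x₀ : Vec d} {ε₀ : ℝ}
    (hx : Filter.Tendsto x Filter.atTop (nhds x₀)) (hε : Filter.Tendsto ε Filter.atTop (nhds ε₀))
    (hle : ∀ n, f (x n) ≤ ε n) : f x₀ ≤ ε₀ :=
  (isClosed_epigraph hcl).mem_of_tendsto (hx.prodMk_nhds hε) (Filter.Eventually.of_forall hle)

/-- The perturbation epigraph is closed over the zero perturbation. Minimizing points may be
projected onto the span of the domains of the conjugates, since the functions do not see the
orthogonal complement; the projections are bounded, because a direction in which they escape would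
be a common direction of recession, hence orthogonal to the span that contains it. -/
theorem exists_le_of_mem_closure {f₀ : Vec d → EReal} {c : K → Vec d → EReal}
    (hp₀ : IsProper f₀) (hl₀ : LowerSemicontinuous f₀) (hc₀ : IsConvex f₀)
    (hp : ∀ k, IsProper (c k)) (hl : ∀ k, LowerSemicontinuous (c k)) (hc : ∀ k, IsConvex (c k))
    (hrec : NoOneSidedRecession f₀ c) {t : ℝ}
    (ht : ((0 : K → Vec d × ℝ), t) ∈ closure (perturbationEpigraph f₀ c)) :
    ∃ x, f₀ x ≤ t ∧ ∀ k, c k x ≤ 0 := by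
  obtain ⟨q, hq, hlim⟩ := mem_closure_iff_seq_limit.1 ht
  choose v hv₀ hv using hq
  set W : Submodule ℝ (Vec d) := Submodule.span ℝ (dom (conj f₀) ∪ ⋃ k, dom (conj (c k)))
  have hW₀ : ∀ y ∈ dom (conj f₀), y ∈ W := fun y hy => Submodule.subset_span (Or.inl hy)
  have hW : ∀ k, ∀ y ∈ dom (conj (c k)), y ∈ W := fun k y hy =>
    Submodule.subset_span (Or.inr (Set.mem_iUnion.2 ⟨k, hy⟩))
  have hproj : ∀ y ∈ W, ∀ x, inner ℝ y (W.starProjection x) = inner ℝ y x := by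
    intro y hy x
    rw [← Submodule.inner_starProjection_left_eq_right, Submodule.starProjection_eq_self_iff.2 hy]
  set x : ℕ → Vec d := fun n => W.starProjection (v n)
  have hxW : ∀ n, x n ∈ W := fun n => Submodule.starProjection_apply_mem W (v n)
  have hx₀ : ∀ n, f₀ (x n) ≤ ((q n).2 : EReal) := fun n =>
    (eq_of_inner_eq hp₀ hl₀ hc₀ fun y hy => hproj y (hW₀ y hy) (v n)).le.trans (hv₀ n)
  have hx : ∀ k n, c k (x n + ((q n).1 k).1) ≤ (((q n).1 k).2 : EReal) := fun k n =>
    (eq_of_inner_eq (hp k) (hl k) (hc k) fun y hy => by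
      rw [inner_add_right, inner_add_right, hproj y (hW k y hy) (v n)]).le.trans (hv n k)
  have hr : Filter.Tendsto (fun n => (q n).2) Filter.atTop (nhds t) :=
    (continuous_snd.tendsto _).comp hlim
  have hu : ∀ k, Filter.Tendsto (fun n => ((q n).1 k).1) Filter.atTop (nhds 0) := fun k =>
    ((by fun_prop : Continuous fun p : (K → Vec d × ℝ) × ℝ => (p.1 k).1).tendsto
      ((0 : K → Vec d × ℝ), t)).comp hlim
  have hε : ∀ k, Filter.Tendsto (fun n => ((q n).1 k).2) Filter.atTop (nhds 0) := fun k =>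
    ((by fun_prop : Continuous fun p : (K → Vec d × ℝ) × ℝ => (p.1 k).2).tendsto
      ((0 : K → Vec d × ℝ), t)).comp hlim
  by_cases hb : ∃ R : ℝ, ∃ᶠ n in Filter.atTop, x n ∈ Metric.closedBall (0 : Vec d) R
  · obtain ⟨R, hR⟩ := hb
    obtain ⟨x₀, -, φ, hφ, hx₀lim⟩ :=
      tendsto_subseq_of_frequently_bounded Metric.isBounded_closedBall hR
    have hφ' := hφ.tendsto_atTop
    refine ⟨x₀, le_of_tendsto_epigraph hl₀ hx₀lim (hr.comp hφ') fun n => hx₀ (φ n), fun k => ?_⟩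
    have h1 := hx₀lim.add ((hu k).comp hφ')
    rw [add_zero] at h1
    exact le_of_tendsto_epigraph (hl k) h1 ((hε k).comp hφ') fun n => hx k (φ n)
  · exfalso
    push Not at hb
    have hnorm : Filter.Tendsto (fun n => ‖x n‖) Filter.atTop Filter.atTop := by
      refine Filter.tendsto_atTop.2 fun R => ?_
      filter_upwards [hb R] with n hn
      simp at hn
      exact hn.le
    have hball : ∀ n, ‖x n‖⁻¹ • x n ∈ Metric.closedBall (0 : Vec d) 1 := by
      intro n
      rw [mem_closedBall_zero_iff, norm_smul, norm_inv, norm_norm]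
      exact inv_mul_le_one
    obtain ⟨h, -, φ, hφ, hh⟩ := tendsto_subseq_of_bounded Metric.isBounded_closedBall hball
    have hφ' := hφ.tendsto_atTop
    have hnorm' := hnorm.comp hφ'
    have hh1 : ‖h‖ = 1 := by
      refine tendsto_nhds_unique hh.norm (tendsto_const_nhds.congr' ?_)
      filter_upwards [hnorm'.eventually_gt_atTop 0] with n hn
      have hn : 0 < ‖x (φ n)‖ := hn
      simp [norm_smul, inv_mul_cancel₀ hn.ne']
    have hhW : h ∈ W := W.closed_of_finiteDimensional.mem_of_tendsto hh
      (Filter.Eventually.of_forall fun n => W.smul_mem _ (hxW _))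
    obtain ⟨e₀, e⟩ := hrec h
      (fun y hy => inner_nonpos_of_tendsto hp₀ (tendsto_const_nhds (x := (0 : Vec d)))
        (hr.comp hφ') hnorm' hh (fun n => by simpa using hx₀ (φ n)) hy)
      (fun k y hy => inner_nonpos_of_tendsto (hp k) ((hu k).comp hφ') ((hε k).comp hφ') hnorm' hh
        (fun n => hx k (φ n)) hy)
    have horth : ∀ w ∈ W, inner ℝ w h = 0 := by
      intro w hw
      induction hw using Submodule.span_induction with
      | mem y hy =>
        rcases hy with hy | hy
        · exact e₀ y hy
        · obtain ⟨k, hk⟩ := Set.mem_iUnion.1 hy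
          exact e k y hk
      | zero => simp
      | add y z _ _ hy hz => rw [inner_add_left, hy, hz, add_zero]
      | smul s y _ hy => rw [inner_smul_left, hy, mul_zero]
    have : h = 0 := inner_self_eq_zero.1 (horth h hhW)
    simp [this] at hh1

theorem coe_sum_ereal {κ : Type*} (s : Finset κ) (A : κ → ℝ) :
    ((∑ k ∈ s, A k : ℝ) : EReal) = ∑ k ∈ s, (A k : EReal) :=
  map_sum (⟨⟨Real.toEReal, EReal.coe_zero⟩, EReal.coe_add⟩ : ℝ →+ EReal) _ _

/-- Finitely many independent suprema can be taken one at a time inside a bounded sum. -/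
theorem exists_upperBounds_sum_le {κ : Type*} [Fintype κ] {V : κ → Set ℝ}
    (hV : ∀ k, (V k).Nonempty) {T : ℝ} (h : ∀ v : κ → ℝ, (∀ k, v k ∈ V k) → ∑ k, v k ≤ T) :
    ∃ A : κ → ℝ, (∀ k, ∀ v ∈ V k, v ≤ A k) ∧ ∑ k, A k ≤ T := by
  classical
  choose w hw using hV
  have hbdd : ∀ k, BddAbove (V k) := by
    intro k
    refine ⟨T - ∑ j ∈ Finset.univ.erase k, w j, fun v hv => ?_⟩
    have h1 := h (Function.update w k v) fun j => by
      rcases eq_or_ne j k with rfl | hj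
      · simpa using hv
      · simpa [hj] using hw j
    rw [← Finset.add_sum_erase _ _ (Finset.mem_univ k), Function.update_self,
      Finset.sum_congr rfl fun j hj => Function.update_of_ne (Finset.ne_of_mem_erase hj) v w] at h1
    linarith
  refine ⟨fun k => sSup (V k), fun k v hv => le_csSup (hbdd k) hv, ?_⟩
  refine le_of_forall_pos_le_add fun ε hε => ?_
  have hN : (0 : ℝ) < Fintype.card κ + 1 := by positivity
  choose v hv hlt using fun k =>
    exists_lt_of_lt_csSup ⟨w k, hw k⟩ (sub_lt_self (sSup (V k)) (div_pos hε hN))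
  have h2 : ∑ k, (sSup (V k) - ε / (Fintype.card κ + 1)) ≤ ∑ k, v k :=
    Finset.sum_le_sum fun k _ => (hlt k).le
  rw [Finset.sum_sub_distrib, Finset.sum_const, Finset.card_univ, nsmul_eq_mul] at h2
  have h3 : (Fintype.card κ : ℝ) * (ε / (Fintype.card κ + 1)) ≤ ε := by
    rw [mul_div_assoc', div_le_iff₀ hN]
    nlinarith
  linarith [h v hv]

/-- A continuous linear functional of the perturbations `(u_k, ε_k)` is given by multipliers `z_k`
and `β_k`; the sign makes `β_k ≥ 0` the condition for monotonicity in `ε_k`. -/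
theorem exists_pairing_eq (l : (K → Vec d × ℝ) →L[ℝ] ℝ) :
    ∃ (z : K → Vec d) (β : K → ℝ), ∀ q, l q = ∑ k, (inner ℝ (z k) (q k).1 - β k * (q k).2) := by
  classical
  choose z hz using fun k => exists_inner_eq
    (l.comp ((ContinuousLinearMap.single ℝ (fun _ : K => Vec d × ℝ) k).comp
      (ContinuousLinearMap.inl ℝ (Vec d) ℝ)))
  refine ⟨z, fun k => -l (Pi.single k (0, 1)), fun q => ?_⟩
  have h1 : l q = ∑ k, l (Pi.single k (q k)) := by
    rw [← map_sum, Finset.univ_sum_single]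
  rw [h1]
  refine Finset.sum_congr rfl fun k _ => ?_
  rw [← hz]
  have h2 : q k = ((q k).1, 0) + (q k).2 • (0, 1) := by simp
  have h3 : l (Pi.single k (q k)) = l (Pi.single k ((q k).1, 0)) + (q k).2 * l (Pi.single k (0, 1)) := by
    conv_lhs => rw [h2]
    rw [Pi.single_add, Pi.single_smul, map_add, map_smul, smul_eq_mul]
  rw [h3]
  simp [mul_comm]

theorem exists_functional_eq (z : K → Vec d) (β : K → ℝ) :
    ∃ l : (K → Vec d × ℝ) →L[ℝ] ℝ, ∀ q, l q = ∑ k, (inner ℝ (z k) (q k).1 - β k * (q k).2) := by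
  refine ⟨∑ k, ((innerSL ℝ (z k)).comp ((ContinuousLinearMap.fst ℝ (Vec d) ℝ).comp
    (ContinuousLinearMap.proj k)) - β k • (ContinuousLinearMap.snd ℝ (Vec d) ℝ).comp
    (ContinuousLinearMap.proj k)), fun q => ?_⟩
  simp

/-- A bound on the Lagrangian at all choices of points of the epigraphs bounds the dual objective. -/
theorem conj_add_sum_persp_le {f₀ : Vec d → EReal} {c : K → Vec d → EReal}
    (hp₀ : IsProper f₀) (hp : ∀ k, IsProper (c k)) (hl : ∀ k, LowerSemicontinuous (c k))
    (hc : ∀ k, IsConvex (c k)) {y : Vec d} {z : K → Vec d} {β : K → ℝ} (hβ : ∀ k, 0 ≤ β k)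
    {T : ℝ}
    (key : ∀ x (r : ℝ) (w : K → Vec d) (s : K → ℝ), f₀ x ≤ r → (∀ k, c k (w k) ≤ s k) →
      (inner ℝ y x - r) + ∑ k, (inner ℝ (z k) (w k) - β k * s k) ≤ T) :
    conj f₀ y + ∑ k, persp (conj (c k)) (z k) (β k) ≤ (T : EReal) := by
  let V₀ : Set ℝ := {v | ∃ x, ∃ r : ℝ, f₀ x ≤ r ∧ v = inner ℝ y x - r}
  let V : K → Set ℝ := fun k => {v | ∃ w, ∃ s : ℝ, c k w ≤ s ∧ v = inner ℝ (z k) w - β k * s}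
  let U : Option K → Set ℝ := fun o => o.elim V₀ V
  have hV₀ : V₀.Nonempty := by
    obtain ⟨x, hx⟩ := hp₀.2
    obtain ⟨s, hs⟩ := exists_real_of_mem_dom hp₀.1 (lt_top_iff_ne_top.2 hx : x ∈ dom f₀)
    exact ⟨_, x, s, hs.le, rfl⟩
  have hV : ∀ k, (V k).Nonempty := by
    intro k
    obtain ⟨x, hx⟩ := (hp k).2
    obtain ⟨s, hs⟩ := exists_real_of_mem_dom (hp k).1 (lt_top_iff_ne_top.2 hx : x ∈ dom (c k))
    exact ⟨_, x, s, hs.le, rfl⟩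
  have hU : ∀ v : Option K → ℝ, (∀ o, v o ∈ U o) → ∑ o, v o ≤ T := by
    intro v hv
    obtain ⟨x, r, hx, hv₀⟩ : v none ∈ V₀ := hv none
    have hv' : ∀ k, ∃ w, ∃ s : ℝ, c k w ≤ s ∧ v (some k) = inner ℝ (z k) w - β k * s :=
      fun k => hv (some k)
    choose w s hws hvk using hv'
    rw [Fintype.sum_option, hv₀, Finset.sum_congr rfl fun k _ => hvk k]
    exact key x r w s hx hws
  obtain ⟨A, hA, hsum⟩ := exists_upperBounds_sum_le (V := U)
    (fun o => by cases o with | none => exact hV₀ | some k => exact hV k) hU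
  rw [Fintype.sum_option] at hsum
  refine le_trans (add_le_add
    (conj_le_of_forall hp₀.1 fun x s hx => hA none _ ⟨x, s, hx, rfl⟩)
    (Finset.sum_le_sum fun k _ => persp_conj_le_of_forall (hp k) (hl k) (hc k) (hβ k)
      fun x s hx => hA (some k) _ ⟨x, s, hx, rfl⟩)) ?_
  rw [← coe_sum_ereal, ← EReal.coe_add, EReal.coe_le_coe_iff]
  exact hsum

/-- Strong duality: if no point has `f₀ x ≤ t` and `c_k x ≤ 0`, the dual program, when it has a
point in its domain and there is no one-sided recession, has a
point of value at least `t`. -/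
theorem exists_dual_certificate {f₀ : Vec d → EReal} {c : K → Vec d → EReal}
    (hp₀ : IsProper f₀) (hl₀ : LowerSemicontinuous f₀) (hc₀ : IsConvex f₀)
    (hp : ∀ k, IsProper (c k)) (hl : ∀ k, LowerSemicontinuous (c k)) (hc : ∀ k, IsConvex (c k))
    (hrec : NoOneSidedRecession f₀ c) {y₀ : Vec d} {z₀ : K → Vec d} {β₀ : K → ℝ}
    (hy₀ : conj f₀ y₀ ≠ ⊤) (hz₀ : ∀ k, persp (conj (c k)) (z₀ k) (β₀ k) ≠ ⊤)
    (hbal : y₀ + ∑ k, z₀ k = 0) {t : ℝ} (ht : ¬ ∃ x, f₀ x ≤ t ∧ ∀ k, c k x ≤ 0) :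
    ∃ (y : Vec d) (z : K → Vec d) (β : K → ℝ), (∀ k, 0 ≤ β k) ∧ y + ∑ k, z k = 0 ∧
      conj f₀ y + ∑ k, persp (conj (c k)) (z k) (β k) ≤ ((-t : ℝ) : EReal) := by
  classical
  obtain ⟨x₁, hx₁⟩ := hp₀.2
  obtain ⟨s₁, hs₁⟩ := exists_real_of_mem_dom hp₀.1 (lt_top_iff_ne_top.2 hx₁ : x₁ ∈ dom f₀)
  have hw : ∀ k, ∃ (w : Vec d) (s : ℝ), c k w = s := fun k => by
    obtain ⟨w, hw⟩ := (hp k).2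
    exact ⟨w, exists_real_of_mem_dom (hp k).1 (lt_top_iff_ne_top.2 hw)⟩
  choose w₁ σ₁ hw₁ using hw
  -- any choice of points in the epigraphs is a point of the perturbation epigraph
  have hmem : ∀ x (r : ℝ) (w : K → Vec d) (s : K → ℝ), f₀ x ≤ r → (∀ k, c k (w k) ≤ s k) →
      ((fun k => (w k - x, s k)), r) ∈ perturbationEpigraph f₀ c :=
    fun x r w s hx hw => ⟨x, hx, fun k => by simpa using hw k⟩
  have hup : ∀ e (r r' : ℝ), (e, r) ∈ perturbationEpigraph f₀ c → r ≤ r' →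
      (e, r') ∈ perturbationEpigraph f₀ c := fun e r r' ⟨x, hx, h⟩ h' =>
    ⟨x, le_trans hx (EReal.coe_le_coe_iff.2 h'), h⟩
  have hbase : ∃ (l : (K → Vec d × ℝ) →L[ℝ] ℝ) (M : ℝ),
      ∀ e r, (e, r) ∈ perturbationEpigraph f₀ c → l e - r ≤ M := by
    obtain ⟨l, hl'⟩ := exists_functional_eq z₀ β₀
    refine ⟨l, (conj f₀ y₀).toReal + ∑ k, (persp (conj (c k)) (z₀ k) (β₀ k)).toReal, ?_⟩
    rintro e r ⟨x, hx, h⟩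
    have h1 := inner_le_add_of_conj_le hx (EReal.coe_toReal hy₀ (conj_ne_bot hp₀ y₀)).ge
    have h2 : ∑ k, inner ℝ (z₀ k) (x + (e k).1) ≤
        ∑ k, (β₀ k * (e k).2 + (persp (conj (c k)) (z₀ k) (β₀ k)).toReal) :=
      Finset.sum_le_sum fun k _ => inner_le_of_persp_conj_le (nonneg_of_persp_ne_top (hz₀ k)) (h k)
        (EReal.coe_toReal (hz₀ k) (persp_conj_ne_bot (hp k) _ _)).ge
    simp only [inner_add_right, Finset.sum_add_distrib] at h2
    have h3 : inner ℝ y₀ x + ∑ k, inner ℝ (z₀ k) x = 0 := by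
      rw [← sum_inner, ← inner_add_left, hbal, inner_zero_left]
    rw [hl', Finset.sum_sub_distrib]
    linarith
  have hne : (perturbationEpigraph f₀ c).Nonempty :=
    ⟨_, hmem x₁ s₁ w₁ σ₁ hs₁.le fun k => (hw₁ k).le⟩
  have hout : ((0 : K → Vec d × ℝ), t) ∉ closure (perturbationEpigraph f₀ c) :=
    fun h => ht (exists_le_of_mem_closure hp₀ hl₀ hc₀ hp hl hc hrec h)
  have hcv := convex_perturbationEpigraph hc₀ hc
  -- only the convexity of the perturbation epigraph and the facts above matter from here on
  generalize perturbationEpigraph f₀ c = C at *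
  obtain ⟨l, hl'⟩ := exists_nonvertical_separating hcv hne hup hout hbase
  obtain ⟨z, β, hzβ⟩ := exists_pairing_eq l
  rw [map_zero, zero_sub] at hl'
  have key : ∀ x (r : ℝ) (w : K → Vec d) (s : K → ℝ), f₀ x ≤ r → (∀ k, c k (w k) ≤ s k) →
      (inner ℝ (-∑ k, z k) x - r) + ∑ k, (inner ℝ (z k) (w k) - β k * s k) ≤ -t := by
    intro x r w s hx hw
    have h1 := hl' _ _ (hmem x r w s hx hw)
    rw [hzβ] at h1
    simp only [inner_sub_right, Finset.sum_sub_distrib] at h1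
    rw [inner_neg_left, sum_inner, Finset.sum_sub_distrib]
    linarith
  have hβ : ∀ k, 0 ≤ β k := by
    intro k
    by_contra! hk
    -- enlarging the `k`-th right-hand side would make the functional unbounded
    set B := (inner ℝ (-∑ k, z k) x₁ - s₁) + ∑ k, (inner ℝ (z k) (w₁ k) - β k * σ₁ k)
    obtain ⟨n, hn⟩ := exists_nat_gt ((-t - B) / -β k)
    rw [div_lt_iff₀ (neg_pos.2 hk)] at hn
    have h1 := key x₁ s₁ w₁ (σ₁ + Pi.single k (n : ℝ)) hs₁.le fun j => by
      rw [hw₁, EReal.coe_le_coe_iff, Pi.add_apply, le_add_iff_nonneg_right, Pi.single_apply]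
      split_ifs <;> simp
    have h2 : ∑ j, (inner ℝ (z j) (w₁ j) - β j * (σ₁ + Pi.single k (n : ℝ) : K → ℝ) j) =
        ∑ j, (inner ℝ (z j) (w₁ j) - β j * σ₁ j) - β k * n := by
      simp only [Pi.add_apply, mul_add, Finset.sum_sub_distrib, Finset.sum_add_distrib]
      simp [Pi.single_apply]
      ring
    rw [h2] at h1
    linarith
  exact ⟨-∑ k, z k, z, β, hβ, by simp, conj_add_sum_persp_le hp₀ hp hl hc hβ key⟩

end StrongDuality

/-! ### Relative interiors and Slater points of the dual program -/

/-- A linear functional that attains its maximum over a set at a point of the relative interior is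
constant on the set. -/
theorem eq_of_mem_intrinsicInterior {E : Type*} [NormedAddCommGroup E] [NormedSpace ℝ E]
    {s : Set E} {w : E} (hw : w ∈ intrinsicInterior ℝ s) (l : E →ₗ[ℝ] ℝ)
    (hl : ∀ v ∈ s, l v ≤ l w) {v : E} (hv : v ∈ s) : l v = l w := by
  obtain ⟨y, hy, rfl⟩ := mem_intrinsicInterior.1 hw
  have hmem : ∀ r : ℝ, AffineMap.lineMap (y : E) v r ∈ affineSpan ℝ s := fun r =>
    AffineMap.lineMap_mem r y.2 (subset_affineSpan ℝ s hv)
  have hcont : Continuous fun r : ℝ =>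
      (⟨AffineMap.lineMap (y : E) v r, hmem r⟩ : affineSpan ℝ s) :=
    AffineMap.lineMap_continuous.subtype_mk hmem
  have h0 : (⟨AffineMap.lineMap (y : E) v (0 : ℝ), hmem 0⟩ : affineSpan ℝ s) = y :=
    Subtype.ext (by simp)
  have hev : ∀ᶠ r : ℝ in nhds 0, AffineMap.lineMap (y : E) v r ∈ s :=
    hcont.tendsto' 0 y h0 (mem_interior_iff_mem_nhds.1 hy)
  obtain ⟨δ, hδ, hball⟩ := Metric.eventually_nhds_iff.1 hev
  have h1 := hl _ (hball (y := -(δ / 2)) (by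
    rw [dist_zero_right, norm_neg, Real.norm_of_nonneg (by linarith)]
    linarith))
  rw [AffineMap.lineMap_apply, vsub_eq_sub, vadd_eq_add, map_add, map_smul, map_sub,
    smul_eq_mul] at h1
  refine le_antisymm (hl v hv) ?_
  nlinarith

section EReal

variable {κ : Type*} {f : κ → EReal}

theorem sum_ne_bot (s : Finset κ) (hf : ∀ k, f k ≠ ⊥) : ∑ k ∈ s, f k ≠ ⊥ := by
  classical
  induction s using Finset.induction_on with
  | empty => simp
  | insert k s hk ih =>
    rw [Finset.sum_insert hk]
    exact EReal.add_ne_bot_iff.2 ⟨hf k, ih⟩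

/-- In a sum without terms `-∞`, a single term `+∞` makes the sum `+∞`. -/
theorem ne_top_of_add_sum_ne_top [Fintype κ] {e : EReal} (he : e ≠ ⊥) (hf : ∀ k, f k ≠ ⊥)
    (h : e + ∑ k, f k ≠ ⊤) : e ≠ ⊤ ∧ ∀ k, f k ≠ ⊤ := by
  classical
  refine ⟨fun h' => h ?_, fun k h' => h ?_⟩
  · rw [h', EReal.top_add_of_ne_bot (sum_ne_bot _ hf)]
  · rw [← Finset.add_sum_erase _ _ (Finset.mem_univ k), h',
      EReal.top_add_of_ne_bot (sum_ne_bot _ hf), EReal.add_top_of_ne_bot he]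

theorem add_sum_toReal [Fintype κ] {e : EReal} (he : e ≠ ⊥) (hf : ∀ k, f k ≠ ⊥)
    (he' : e ≠ ⊤) (hf' : ∀ k, f k ≠ ⊤) :
    e + ∑ k, f k = ((e.toReal + ∑ k, (f k).toReal : ℝ) : EReal) := by
  rw [EReal.coe_add, coe_sum_ereal, EReal.coe_toReal he' he]
  exact congrArg _ (Finset.sum_congr rfl fun k _ => (EReal.coe_toReal (hf' k) (hf k)).symm)

end EReal

section Components

variable {d : ℕ} {I J : Type*} [Fintype J] [Nonempty J]

theorem isProper_comp (a : I → J → Vec d) (b : I → J → ℝ) (i : I) : IsProper (comp a b i) :=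
  ⟨fun _ => EReal.coe_ne_bot _, 0, EReal.coe_ne_top _⟩

theorem lowerSemicontinuous_comp (a : I → J → Vec d) (b : I → J → ℝ) (i : I) :
    LowerSemicontinuous (comp a b i) := by
  refine (continuous_coe_real_ereal.comp ?_).lowerSemicontinuous
  unfold maxAffine
  refine Continuous.finset_sup'_apply _ fun j _ => ?_
  fun_prop

theorem isConvex_comp (a : I → J → Vec d) (b : I → J → ℝ) (i : I) : IsConvex (comp a b i) := by
  rintro ⟨x, r⟩ hx ⟨x', r'⟩ hx' s t hs ht hst
  have hx : ∀ j, inner ℝ (a i j) x + b i j ≤ r := by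
    simpa [comp, maxAffine] using hx
  have hx' : ∀ j, inner ℝ (a i j) x' + b i j ≤ r' := by
    simpa [comp, maxAffine] using hx'
  change ((_ : ℝ) : EReal) ≤ ((_ : ℝ) : EReal)
  rw [EReal.coe_le_coe_iff]
  refine Finset.sup'_le _ _ fun j _ => ?_
  change inner ℝ (a i j) (s • x + t • x') + b i j ≤ s * r + t * r'
  rw [inner_add_right, inner_smul_right, inner_smul_right]
  have h1 := mul_le_mul_of_nonneg_left (hx j) hs
  have h2 := mul_le_mul_of_nonneg_left (hx' j) ht
  have h3 : b i j = s * b i j + t * b i j := by rw [← add_mul, hst, one_mul]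
  linarith

end Components

section DualSlater

variable {d : ℕ} {I J K : Type*} [Fintype J] [Fintype K] [Nonempty J]
  {a : I → J → Vec d} {b : I → J → ℝ} {c : K → Vec d → EReal}

theorem mem_dom_dualConstr_iff (hc : ∀ k, IsProper (c k)) {i : I} {α : ℝ} {β : I → K → ℝ}
    {y : I → Vec d} {z : I → K → Vec d} :
    (α, β, y, z) ∈ dom (dualConstr a b c i) ↔
      conj (comp a b i) (y i) ≠ ⊤ ∧ ∀ k, persp (conj (c k)) (z i k) (β i k) ≠ ⊤ := by
  have he := conj_ne_bot (isProper_comp a b i) (y i)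
  have hf := fun k => persp_conj_ne_bot (hc k) (z i k) (β i k)
  constructor
  · intro h
    refine ne_top_of_add_sum_ne_top he hf fun htop => ?_
    have h' : conj (comp a b i) (y i) + ∑ k, persp (conj (c k)) (z i k) (β i k) -
      ((α : ℝ) : EReal) < ⊤ := h
    rw [htop, EReal.top_sub_coe] at h'
    exact lt_irrefl _ h'
  · rintro ⟨h1, h2⟩
    change conj (comp a b i) (y i) + ∑ k, persp (conj (c k)) (z i k) (β i k) -
      ((α : ℝ) : EReal) < ⊤
    rw [add_sum_toReal he hf h1 h2, ← EReal.coe_sub]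
    exact EReal.coe_lt_top _

/-- The pairing of `h` with the left-hand side of the `i`-th balance equation. -/
def balancePairing (i : I) (h : Vec d) : DualVar d I K →ₗ[ℝ] ℝ where
  toFun w := inner ℝ (w.2.2.1 i + ∑ k, w.2.2.2 i k) h
  map_add' v w := by
    simp only [Prod.snd_add, Prod.fst_add, Pi.add_apply, Finset.sum_add_distrib, ← inner_add_left]
    congr 1
    abel
  map_smul' r w := by
    simp only [Prod.smul_snd, Prod.smul_fst, Pi.smul_apply, ← Finset.smul_sum, ← smul_add,
      inner_smul_left]
    simp

theorem balancePairing_apply (i : I) (h : Vec d) (α : ℝ) (β : I → K → ℝ) (y : I → Vec d)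
    (z : I → K → Vec d) :
    balancePairing i h (α, β, y, z) = inner ℝ (y i) h + ∑ k, inner ℝ (z i k) h := by
  change inner ℝ (y i + ∑ k, z i k) h = _
  rw [inner_add_left, sum_inner]

variable [Fintype I]

/-- What a Slater point provides for each `i`: a point in the domain of the dual objective
satisfying the balance equation, and the absence of one-sided recession directions. -/
theorem DualSlater.exists_point (hslater : DualSlater a b c) (hp : ∀ k, IsProper (c k))
    (hl : ∀ k, LowerSemicontinuous (c k)) (hc : ∀ k, IsConvex (c k)) (i : I) :
    NoOneSidedRecession (comp a b i) c ∧ ∃ (y : Vec d) (z : K → Vec d) (β : K → ℝ),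
      conj (comp a b i) y ≠ ⊤ ∧ (∀ k, persp (conj (c k)) (z k) (β k) ≠ ⊤) ∧ y + ∑ k, z k = 0 := by
  classical
  obtain ⟨⟨α, β, y, z⟩, -, h1, h2⟩ := hslater
  have hri : (α, β, y, z) ∈ intrinsicInterior ℝ (dom (dualConstr a b c i)) := (h1 (Sum.inl i)).1
  have hdom := (mem_dom_dualConstr_iff hp).1 (intrinsicInterior_subset hri)
  have hbal : y i + ∑ k, z i k = 0 := by
    ext l
    have h3 : (((y i + ∑ k, z i k) l : ℝ) : EReal) = 0 := (h2 (i, l)).2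
    exact EReal.coe_eq_zero.1 h3
  refine ⟨fun h hh₀ hh => ?_, y i, z i, β i, hdom.1, hdom.2, hbal⟩
  have hzero : balancePairing i h (α, β, y, z) = 0 := by
    change inner ℝ (y i + ∑ k, z i k) h = 0
    rw [hbal, inner_zero_left]
  have hnonpos : ∀ (β' : I → K → ℝ) (y' : I → Vec d) (z' : I → K → Vec d),
      (α, β', y', z') ∈ dom (dualConstr a b c i) →
        inner ℝ (y' i) h ≤ 0 ∧ ∀ k, inner ℝ (z' i k) h ≤ 0 := by
    intro β' y' z' hm
    obtain ⟨hm₀, hm⟩ := (mem_dom_dualConstr_iff hp).1 hm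
    exact ⟨hh₀ _ (lt_top_iff_ne_top.2 hm₀), fun k => inner_nonpos_of_persp_conj_ne_top (hp k)
      (dom_conj_nonempty (hp k) (hl k) (hc k)) (hh k) (hm k)⟩
  -- the pairing is nonpositive on the domain and vanishes at a relatively interior point
  have heq : ∀ (β' : I → K → ℝ) (y' : I → Vec d) (z' : I → K → Vec d),
      (α, β', y', z') ∈ dom (dualConstr a b c i) →
        inner ℝ (y' i) h = 0 ∧ ∀ k, inner ℝ (z' i k) h = 0 := by
    intro β' y' z' hm
    have h3 := eq_of_mem_intrinsicInterior hri (balancePairing i h) (fun v hv => by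
      obtain ⟨α', β'', y'', z''⟩ := v
      have h4 := hnonpos β'' y'' z''
        ((mem_dom_dualConstr_iff hp).2 ((mem_dom_dualConstr_iff hp).1 hv))
      rw [hzero, balancePairing_apply]
      exact add_nonpos h4.1 (Finset.sum_nonpos fun k _ => h4.2 k)) hm
    rw [hzero, balancePairing_apply] at h3
    obtain ⟨h5, h6⟩ := hnonpos β' y' z' hm
    have h7 : ∑ k, inner ℝ (z' i k) h ≤ 0 := Finset.sum_nonpos fun k _ => h6 k
    refine ⟨by linarith, fun k => ?_⟩
    exact (Finset.sum_eq_zero_iff_of_nonpos fun k _ => h6 k).1 (by linarith) k (Finset.mem_univ k)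
  refine ⟨fun v hv => ?_, fun k v hv => ?_⟩
  · exact (heq β (fun _ => v) z ((mem_dom_dualConstr_iff hp).2 ⟨ne_of_lt hv, hdom.2⟩)).1
  · have h3 := (heq (fun _ => Function.update (β i) k 1) y (fun _ => Function.update (z i) k v)
      ((mem_dom_dualConstr_iff hp).2 ⟨hdom.1, fun j => ?_⟩)).2 k
    · simpa using h3
    · rcases eq_or_ne j k with rfl | hj
      · rw [Function.update_self, Function.update_self, persp_of_pos _ _ one_pos]
        simpa using ne_of_lt hv
      · simpa [hj] using hdom.2 j

end DualSlater

/-! ### The lifted problem as minimization over points -/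

section Lifted

variable {d : ℕ} {I J : Type*} [Fintype I] [Fintype J] [Nonempty I] [Nonempty J]
  {a : I → J → Vec d} {b : I → J → ℝ}

theorem liftedValue_le_of_mem (g : Vec d → ℝ) {X : Set (Vec d)} {x : Vec d} (hx : x ∈ X) :
    liftedValue g X ≤ (g x : EReal) := by
  have hμ : Measure.dirac x ∈ probOn X := ⟨inferInstance, by simp [Measure.dirac_apply, hx]⟩
  refine (iInf₂_le (Measure.dirac x) hμ).trans ?_
  rw [integral_dirac]

/-- A lower bound for `g` on a bounded set is one for the lifted problem, because `g` is at
most its mean at some point of the set. -/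
theorem le_liftedValue {X : Set (Vec d)} (hX : Bornology.IsBounded X) {m : EReal}
    (h : ∀ x ∈ X, m ≤ (minMaxAffine a b x : EReal)) : m ≤ liftedValue (minMaxAffine a b) X := by
  refine le_iInf₂ fun μ hμ => ?_
  have := hμ.1
  obtain ⟨x, hx, hle⟩ := exists_notMem_null_le_integral (integrable_minMaxAffine a b hX hμ) hμ.2
  exact (h x (not_not.1 hx)).trans (EReal.coe_le_coe_iff.2 hle)

theorem minMaxAffine_le (a : I → J → Vec d) (b : I → J → ℝ) (i : I) (x : Vec d) :
    minMaxAffine a b x ≤ maxAffine (a i) (b i) x :=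
  Finset.inf'_le _ (Finset.mem_univ i)

theorem exists_minMaxAffine_eq (a : I → J → Vec d) (b : I → J → ℝ) (x : Vec d) :
    ∃ i, minMaxAffine a b x = maxAffine (a i) (b i) x := by
  obtain ⟨i, -, hi⟩ := Finset.exists_mem_eq_inf' Finset.univ_nonempty
    fun i => maxAffine (a i) (b i) x
  exact ⟨i, hi⟩

end Lifted

/-! ### The finite convex program -/

section Primal

variable {d : ℕ} {I J K : Type*} [Fintype I] [Fintype J] [Nonempty J]
  {a : I → J → Vec d} {b : I → J → ℝ} {c : K → Vec d → EReal}
  {η lam : I → ℝ} {x : I → Vec d}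

theorem PrimalFeasible.smul_mem (h : PrimalFeasible a b c η lam x) {i : I} (hi : lam i ≠ 0) :
    (lam i)⁻¹ • x i ∈ supportSet c := by
  intro k
  have hpos : 0 < lam i := lt_of_le_of_ne (h.nonneg i) hi.symm
  have h1 := h.constr i k
  rw [persp_of_pos _ _ hpos, ← EReal.coe_zero, coe_mul_le_coe_iff hpos, mul_zero] at h1
  exact h1

theorem PrimalFeasible.mul_maxAffine_le (h : PrimalFeasible a b c η lam x) {i : I}
    (hi : lam i ≠ 0) : lam i * maxAffine (a i) (b i) ((lam i)⁻¹ • x i) ≤ η i := by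
  have hpos : 0 < lam i := lt_of_le_of_ne (h.nonneg i) hi.symm
  have h1 := h.epi i
  rw [persp_of_pos _ _ hpos, comp, ← EReal.coe_mul, EReal.coe_le_coe_iff] at h1
  exact h1

theorem PrimalFeasible.exists_ne_zero (h : PrimalFeasible a b c η lam x) : ∃ i, lam i ≠ 0 := by
  by_contra! h0
  have := h.sum_eq_one
  simp [h0] at this

/-- At an index of weight zero, `x_i` is a direction of recession of the bounded support set. -/
theorem PrimalFeasible.eq_zero (hp : ∀ k, IsProper (c k))
    (hl : ∀ k, LowerSemicontinuous (c k)) (hc : ∀ k, IsConvex (c k))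
    (hX : Bornology.IsBounded (supportSet c)) (h : PrimalFeasible a b c η lam x) {i : I}
    (hi : lam i = 0) : x i = 0 := by
  obtain ⟨i₀, hi₀⟩ := h.exists_ne_zero
  have hu := h.smul_mem hi₀
  set u := (lam i₀)⁻¹ • x i₀
  have hrec : ∀ s : ℝ, 0 ≤ s → u + s • x i ∈ supportSet c := fun s hs k => by
    have h1 := h.constr i k
    rw [hi, persp_zero] at h1
    refine (add_smul_le (hp k) (hl k) (hc k) (fun y hy => ?_) hs).trans (hu k)
    exact EReal.coe_le_coe_iff.1 (iSup₂_le_iff.1 h1 y hy)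
  obtain ⟨R, hR⟩ := hX.exists_norm_le
  by_contra hne
  have hpos : 0 < ‖x i‖ := norm_pos_iff.2 hne
  obtain ⟨n, hn⟩ := exists_nat_gt ((R + ‖u‖) / ‖x i‖)
  rw [div_lt_iff₀ hpos] at hn
  have h2 := hR _ (hrec n n.cast_nonneg)
  have h3 : ‖(n : ℝ) • x i‖ ≤ ‖u + (n : ℝ) • x i‖ + ‖u‖ := by
    have := norm_sub_le (u + (n : ℝ) • x i) u
    rwa [add_sub_cancel_left] at this
  rw [norm_smul, Real.norm_natCast] at h3
  linarith

theorem PrimalFeasible.nonneg_of_eq_zero (hp : ∀ k, IsProper (c k))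
    (hl : ∀ k, LowerSemicontinuous (c k)) (hc : ∀ k, IsConvex (c k))
    (hX : Bornology.IsBounded (supportSet c)) (h : PrimalFeasible a b c η lam x) {i : I}
    (hi : lam i = 0) : 0 ≤ η i := by
  have h1 := h.epi i
  rw [hi, h.eq_zero hp hl hc hX hi, persp_zero] at h1
  obtain ⟨y, hy⟩ := dom_conj_nonempty (isProper_comp a b i) (lowerSemicontinuous_comp a b i)
    (isConvex_comp a b i)
  have h2 := EReal.coe_le_coe_iff.1 (iSup₂_le_iff.1 h1 y hy)
  rwa [inner_zero_right] at h2

theorem PrimalFeasible.discreteMeasure_mem (h : PrimalFeasible a b c η lam x) :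
    discreteMeasure lam x ∈ probOn (supportSet c) := by
  constructor
  · constructor
    rw [discreteMeasure, Measure.finsetSum_apply]
    simp only [Measure.smul_apply, measure_univ, smul_eq_mul, mul_one]
    rw [← ENNReal.ofReal_sum_of_nonneg fun i _ => h.nonneg i, Finset.sum_filter_ne_zero,
      h.sum_eq_one, ENNReal.ofReal_one]
  · rw [discreteMeasure, Measure.finsetSum_apply]
    refine Finset.sum_eq_zero fun i hi => ?_
    simp [Measure.dirac_apply, h.smul_mem (Finset.mem_filter.1 hi).2]

variable [Nonempty I]

theorem PrimalFeasible.integral_discreteMeasure_le (hp : ∀ k, IsProper (c k))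
    (hl : ∀ k, LowerSemicontinuous (c k)) (hc : ∀ k, IsConvex (c k))
    (hX : Bornology.IsBounded (supportSet c)) (h : PrimalFeasible a b c η lam x) :
    ∫ v, minMaxAffine a b v ∂discreteMeasure lam x ≤ ∑ i, η i := by
  rw [discreteMeasure, integral_finsetSum_measure fun i _ =>
    (integrable_dirac (by simp)).smul_measure ENNReal.ofReal_ne_top]
  simp only [integral_smul_measure, integral_dirac, smul_eq_mul]
  rw [Finset.sum_filter]
  refine Finset.sum_le_sum fun i _ => ?_
  split_ifs with hi
  · rw [ENNReal.toReal_ofReal (h.nonneg i)]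
    exact (mul_le_mul_of_nonneg_left (minMaxAffine_le a b i _) (h.nonneg i)).trans
      (h.mul_maxAffine_le hi)
  · exact h.nonneg_of_eq_zero hp hl hc hX (not_not.1 hi)

theorem primalValue_le_liftedValue (hX : Bornology.IsBounded (supportSet c)) :
    primalValue a b c ≤ liftedValue (minMaxAffine a b) (supportSet c) := by
  classical
  refine le_liftedValue hX fun x hx => ?_
  obtain ⟨i, hi⟩ := exists_minMaxAffine_eq a b x
  -- all the weight goes to an index `i` with `g x = g_i x`
  have hfeas : PrimalFeasible a b c (Pi.single i (minMaxAffine a b x)) (Pi.single i 1)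
      (Pi.single i x) := by
    have hzero : ∀ f : Vec d → EReal, persp f 0 0 ≤ 0 := fun f => by
      rw [persp_zero]
      exact iSup₂_le fun y _ => by simp
    refine ⟨fun j k => ?_, fun j => ?_, by simp, fun j => ?_⟩
    · rcases eq_or_ne j i with rfl | hj
      · simpa [persp_of_pos] using hx k
      · simpa [hj] using hzero _
    · rcases eq_or_ne j i with rfl | hj
      · simp [persp_of_pos, hi, comp]
      · simpa [hj] using hzero _
    · rw [Pi.single_apply]
      split_ifs <;> simp
  refine iInf_le_of_le _ <| iInf_le_of_le _ <| iInf_le_of_le _ <| iInf_le_of_le hfeas ?_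
  simp

end Primal

/-! ### The dual program -/

section Dual

variable {d : ℕ} {I J K : Type*} [Fintype I] [Fintype J] [Fintype K] [Nonempty I] [Nonempty J]
  {a : I → J → Vec d} {b : I → J → ℝ} {c : K → Vec d → EReal}

theorem DualFeasible.neg_le (hp : ∀ k, IsProper (c k)) {α : ℝ} {β : I → K → ℝ}
    {y : I → Vec d} {z : I → K → Vec d} (h : DualFeasible a b c α β y z) {x : Vec d}
    (hx : x ∈ supportSet c) : -α ≤ minMaxAffine a b x := by
  obtain ⟨i, hi⟩ := exists_minMaxAffine_eq a b x
  have he := conj_ne_bot (isProper_comp a b i) (y i)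
  have hf := fun k => persp_conj_ne_bot (hp k) (z i k) (β i k)
  have hle := h.constr i
  obtain ⟨he', hf'⟩ := ne_top_of_add_sum_ne_top he hf
    (ne_of_lt (lt_of_le_of_lt hle (EReal.coe_lt_top α)))
  rw [add_sum_toReal he hf he' hf', EReal.coe_le_coe_iff] at hle
  have h1 := inner_le_add_of_conj_le (f := comp a b i) (x := x) (s := minMaxAffine a b x)
    (by rw [hi]; exact le_rfl) (EReal.coe_toReal he' he).ge
  have h2 : ∑ k, inner ℝ (z i k) x ≤ ∑ k, (persp (conj (c k)) (z i k) (β i k)).toReal := by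
    refine Finset.sum_le_sum fun k _ => ?_
    have := inner_le_of_persp_conj_le (x := x) (s := 0) (h.nonneg i k) (by simpa using hx k)
      (EReal.coe_toReal (hf' k) (hf k)).ge
    linarith
  have h3 : inner ℝ (y i) x + ∑ k, inner ℝ (z i k) x = 0 := by
    rw [← sum_inner, ← inner_add_left, h.balance i, inner_zero_left]
  linarith

theorem dualValue_le_liftedValue (hp : ∀ k, IsProper (c k))
    (hX : Bornology.IsBounded (supportSet c)) :
    dualValue a b c ≤ liftedValue (minMaxAffine a b) (supportSet c) :=
  le_liftedValue hX fun _ hx =>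
    iSup_le fun _ => iSup_le fun _ => iSup_le fun _ => iSup_le fun _ => iSup_le fun h =>
      EReal.coe_le_coe_iff.2 (h.neg_le hp hx)

/-- The dual program splits over `i` into the duals of the problems of minimizing `g_i` on the
support set, which have no duality gap. -/
theorem liftedValue_le_dualValue (hp : ∀ k, IsProper (c k))
    (hl : ∀ k, LowerSemicontinuous (c k)) (hc : ∀ k, IsConvex (c k))
    (hslater : DualSlater a b c) :
    liftedValue (minMaxAffine a b) (supportSet c) ≤ dualValue a b c := by
  refine EReal.ge_of_forall_gt_iff_ge.1 fun t ht => ?_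
  have hcert : ∀ i, ∃ (y : Vec d) (z : K → Vec d) (β : K → ℝ), (∀ k, 0 ≤ β k) ∧
      y + ∑ k, z k = 0 ∧
      conj (comp a b i) y + ∑ k, persp (conj (c k)) (z k) (β k) ≤ ((-t : ℝ) : EReal) := by
    intro i
    obtain ⟨hrec, y₀, z₀, β₀, hy₀, hz₀, hbal⟩ := hslater.exists_point hp hl hc i
    refine exists_dual_certificate (isProper_comp a b i) (lowerSemicontinuous_comp a b i)
      (isConvex_comp a b i) hp hl hc hrec hy₀ hz₀ hbal ?_
    rintro ⟨x, hx, hxX⟩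
    refine not_le.2 ht ((liftedValue_le_of_mem _ (show x ∈ supportSet c from hxX)).trans ?_)
    exact (EReal.coe_le_coe_iff.2 (minMaxAffine_le a b i x)).trans hx
  choose y z β hβ hbal hle using hcert
  refine le_iSup_of_le (-t) <| le_iSup_of_le β <| le_iSup_of_le y <| le_iSup_of_le z <|
    le_iSup_of_le ⟨hle, hbal, hβ⟩ ?_
  rw [neg_neg]

end Dual

end MinMaxCert

end

theorem theorem2 {d : ℕ} {I J K : Type*} [Fintype I] [Fintype J] [Fintype K]
    [Nonempty I] [Nonempty J]
    (a : I → J → MinMaxCert.Vec d) (b : I → J → ℝ)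
    (c : K → MinMaxCert.Vec d → EReal)
    (hproper : ∀ k, MinMaxCert.IsProper (c k))
    (hclosed : ∀ k, LowerSemicontinuous (c k))
    (hconvex : ∀ k, MinMaxCert.IsConvex (c k))
    (hbounded : Bornology.IsBounded (MinMaxCert.supportSet c))
    (hslater : MinMaxCert.DualSlater a b c) :
    MinMaxCert.primalValue a b c
        = MinMaxCert.liftedValue (MinMaxCert.minMaxAffine a b) (MinMaxCert.supportSet c) ∧
      MinMaxCert.liftedValue (MinMaxCert.minMaxAffine a b) (MinMaxCert.supportSet c)
        = MinMaxCert.dualValue a b c ∧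
      ∀ (η lam : I → ℝ) (x : I → MinMaxCert.Vec d),
        MinMaxCert.SolvesPrimal a b c η lam x →
          MinMaxCert.SolvesLifted (MinMaxCert.minMaxAffine a b) (MinMaxCert.supportSet c)
            (MinMaxCert.discreteMeasure lam x) := by
  have hprimal : MinMaxCert.primalValue a b c =
      MinMaxCert.liftedValue (MinMaxCert.minMaxAffine a b) (MinMaxCert.supportSet c) := by
    refine le_antisymm (MinMaxCert.primalValue_le_liftedValue hbounded) ?_
    refine le_iInf fun η => le_iInf fun lam => le_iInf fun x => le_iInf fun h => ?_
    exact (iInf₂_le _ h.discreteMeasure_mem).trans (EReal.coe_le_coe_iff.2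
      (h.integral_discreteMeasure_le hproper hclosed hconvex hbounded))
  refine ⟨hprimal, le_antisymm
    (MinMaxCert.liftedValue_le_dualValue hproper hclosed hconvex hslater)
    (MinMaxCert.dualValue_le_liftedValue hproper hbounded), ?_⟩
  rintro η lam x ⟨hfeas, hopt⟩
  refine ⟨hfeas.discreteMeasure_mem, le_antisymm ?_ (iInf₂_le _ hfeas.discreteMeasure_mem)⟩
  rw [← hprimal, ← hopt, EReal.coe_le_coe_iff]
  exact hfeas.integral_discreteMeasure_le hproper hclosed hconvex hbounded
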